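/- All Hilbert spaces are complex and separable. For a Hilbert space $E$, let $H^2_E(\mathbb{D})$ be the Hardy space of $E$-valued analytic functions $f(z)=\sum_{n\ge 0} a_n z^n$ on the unit disc $\mathbb{D}$ with $\|f\|^2=\sum_n\|a_n\|^2<\infty$, and let $M_z$ be multiplication by $z$ on it. A bounded operator $A$ on $E$ also acts on $H^2_E(\mathbb{D})$ pointwise, $(Af)(z)=A(f(z))$. For $A\in\mathcal{B}(E)$ with numerical radius $w(A)=\sup\{|\langle Ax,x\rangle| : \|x\|=1\}\le 1$, the $\Gamma$-isometric Hardy module $[H^2_E(\mathbb{D})]_A$ with symbol $A$ is the Hilbert module over $\mathbb{C}[z_1,z_2]$ on $H^2_E(\mathbb{D})$ in which $z_1$ and $z_2$ act by the commuting operators $M_1=A+A^*M_z$ and $M_2=M_z$. A submodule of a Hilbert module is a closed subspace invariant under $M_1$ and $M_2$; a module map is a bounded linear map $X$ with $XM_i=M_iX$ for $i=1,2$. **Corollary.** Let $E_*$ be a Hilbert space, let $A\in\mathcal{B}(E_*)$ with $w(A)\le 1$, and let $S\ne\{0\}$ be a closed subspace of $H^2_{E_*}(\mathbb{D})$. Then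 $S$ is a submodule of $[H^2_{E_*}(\mathbb{D})]_A$ if and only if there exist a Hilbert space $E$, an operator $B\in\mathcal{B}(E)$ with $w(B)\le 1$, and an isometric module map $$U:[H^2_E(\mathbb{D})]_B\longrightarrow[H^2_{E_*}(\mathbb{D})]_A\qquad\text{with}\qquad S=U\,H^2_E(\mathbb{D}),$$ where the symbol $B$ is unique in the following two senses: 1. for the given $U$, $B$ is the only operator in $\mathcal{B}(E)$ such that $U(B+B^*M_z)=(A+A^*M_z)U$ and $UM_z=M_zU$; 2. $B$ is unique up to unitary equivalence: if $E'$ is a Hilbert space, $B'\in\mathcal{B}(E')$ with $w(B')\le 1$, and $U':[H^2_{E'}(\mathbb{D})]_{B'}\to[H^2_{E_*}(\mathbb{D})]_A$ is an isometric module map with $S=U'H^2_{E'}(\mathbb{D})$, then there is a unitary $W:E\to E'$ with $WB=B'W$. -/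

import Mathlib

open Complex Topology
open scoped InnerProductSpace ENNReal

universe u

noncomputable section

/-! ### The vector valued Hardy space on the unit disc -/

section Hardy

variable {E : Type*} [NormedAddCommGroup E] [InnerProductSpace ℂ E]
variable {F : Type*} [NormedAddCommGroup F] [InnerProductSpace ℂ F]

/-- `a` is the sequence of Taylor coefficients at `0` of the function `f` on the unit disc:
`f z = ∑ zⁿ aₙ` for all `z` in the disc. -/
def IsTaylorSeq (f : UnitDisc → E) (a : ℕ → E) : Prop :=
  ∀ z : UnitDisc, HasSum (fun n : ℕ => (z : ℂ) ^ n • a n) (f z)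

theorem IsTaylorSeq.add {f g : UnitDisc → E} {a b : ℕ → E} (hf : IsTaylorSeq f a)
    (hg : IsTaylorSeq g b) : IsTaylorSeq (f + g) (a + b) := fun z => by
  simpa [smul_add] using (hf z).add (hg z)

theorem IsTaylorSeq.smul {f : UnitDisc → E} {a : ℕ → E} (c : ℂ) (hf : IsTaylorSeq f a) :
    IsTaylorSeq (c • f) (c • a) := fun z => by
  simpa [smul_comm c] using (hf z).const_smul c

/-- Taylor coefficients are unique. -/
theorem IsTaylorSeq.unique {f : UnitDisc → E} {a b : ℕ → E} (ha : IsTaylorSeq f a)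
    (hb : IsTaylorSeq f b) : a = b := by
  have key : IsTaylorSeq (0 : UnitDisc → E) (a - b) := by
    have h := ha.add (hb.smul (-1))
    have h1 : f + (-1 : ℂ) • f = 0 := by simp
    have h2 : a + (-1 : ℂ) • b = a - b := by simp [sub_eq_add_neg]
    rwa [h1, h2] at h
  let p : FormalMultilinearSeries ℂ ℂ E :=
    fun n => ContinuousMultilinearMap.mkPiRing ℂ (Fin n) ((a - b) n)
  have hc : ∀ n, p.coeff n = (a - b) n := fun n => by
    simp [p, FormalMultilinearSeries.coeff]
  have hp : HasFPowerSeriesAt (0 : ℂ → E) p 0 := by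
    rw [hasFPowerSeriesAt_iff]
    filter_upwards [Metric.ball_mem_nhds (0 : ℂ) one_pos] with z hz
    have hz' : ‖z‖ < 1 := by simpa using hz
    simpa [hc] using key (UnitDisc.mk z hz')
  have h0 := hp.eq_zero
  have : a - b = 0 := by
    funext n
    rw [← hc n, h0]
    simp [FormalMultilinearSeries.coeff]
  exact sub_eq_zero.mp this

variable (E) in
/-- The `E`-valued analytic functions on the unit disc whose Taylor coefficients are square
summable. -/
def hardySubmodule : Submodule ℂ (UnitDisc → E) where
  carrier := {f | ∃ a : ℕ → E, Summable (fun n => ‖a n‖ ^ 2) ∧ IsTaylorSeq f a}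
  zero_mem' := ⟨0, by simp, fun z => by simp⟩
  add_mem' := by
    rintro f g ⟨a, ha, hfa⟩ ⟨b, hb, hgb⟩
    refine ⟨a + b, ?_, hfa.add hgb⟩
    refine Summable.of_nonneg_of_le (fun n => by positivity) (fun n => ?_)
      ((ha.mul_left 2).add (hb.mul_left 2))
    have h1 : ‖a n + b n‖ ≤ ‖a n‖ + ‖b n‖ := norm_add_le _ _
    have h2 : 0 ≤ ‖a n + b n‖ := norm_nonneg _
    simp only [Pi.add_apply]
    nlinarith [sq_nonneg (‖a n‖ - ‖b n‖)]
  smul_mem' := by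
    rintro c f ⟨a, ha, hfa⟩
    refine ⟨c • a, ?_, hfa.smul c⟩
    simpa [norm_smul, mul_pow] using ha.mul_left (‖c‖ ^ 2)

variable (E) in
/-- The Hardy space `H²_E(𝔻)`. It is a type of its own, so that it carries the Hardy norm and not
the topology of pointwise convergence. -/
def HardySpace : Type _ := ↥(hardySubmodule E)

namespace HardySpace

instance : AddCommGroup (HardySpace E) := inferInstanceAs (AddCommGroup (hardySubmodule E))

instance : Module ℂ (HardySpace E) := inferInstanceAs (Module ℂ (hardySubmodule E))

instance : FunLike (HardySpace E) UnitDisc E where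
  coe f := f.1
  coe_injective _ _ h := Subtype.ext h

@[ext] theorem ext {f g : HardySpace E} (h : ∀ z, f z = g z) : f = g := DFunLike.ext _ _ h

@[simp] theorem add_apply (f g : HardySpace E) (z : UnitDisc) : (f + g) z = f z + g z := rfl

@[simp] theorem smul_apply (c : ℂ) (f : HardySpace E) (z : UnitDisc) : (c • f) z = c • f z := rfl

/-- The Taylor coefficients of an element of the Hardy space. -/
def taylor (f : HardySpace E) : ℕ → E := f.2.choose

theorem summable_taylor (f : HardySpace E) : Summable (fun n => ‖f.taylor n‖ ^ 2) :=
  f.2.choose_spec.1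

theorem isTaylorSeq_taylor (f : HardySpace E) : IsTaylorSeq f f.taylor := f.2.choose_spec.2

theorem taylor_eq {f : HardySpace E} {a : ℕ → E} (h : IsTaylorSeq f a) : f.taylor = a :=
  f.isTaylorSeq_taylor.unique h

theorem memlp_iff (a : ℕ → E) : Memℓp a 2 ↔ Summable (fun n => ‖a n‖ ^ 2) := by
  rw [memℓp_gen_iff (by norm_num)]
  simp

/-- The Taylor coefficients as a linear map into `ℓ²(ℕ, E)`. -/
def taylorLin : HardySpace E →ₗ[ℂ] lp (fun _ : ℕ => E) 2 where
  toFun f := ⟨f.taylor, (memlp_iff _).2 f.summable_taylor⟩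
  map_add' f g := Subtype.ext <|
    taylor_eq (f := f + g) (f.isTaylorSeq_taylor.add g.isTaylorSeq_taylor)
  map_smul' c f := Subtype.ext <| taylor_eq (f := c • f) (f.isTaylorSeq_taylor.smul c)

@[simp] theorem taylorLin_apply (f : HardySpace E) (n : ℕ) : taylorLin f n = f.taylor n := rfl

theorem taylorLin_injective : Function.Injective (taylorLin : HardySpace E → _) := by
  intro f g h
  have h' : f.taylor = g.taylor := congrArg Subtype.val h
  ext z
  exact (f.isTaylorSeq_taylor z).unique (h' ▸ g.isTaylorSeq_taylor z)

instance : NormedAddCommGroup (HardySpace E) :=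
  NormedAddCommGroup.induced _ _ (taylorLin (E := E)) taylorLin_injective

/-- The inner product of `H²_E(𝔻)` is `⟪f, g⟫ = ∑ ⟪aₙ, bₙ⟫` for the Taylor coefficients `aₙ` of `f`
and `bₙ` of `g` (see `inner_eq`), so that `‖f‖² = ∑ ‖aₙ‖²` (see `norm_sq_eq`). -/
instance : InnerProductSpace ℂ (HardySpace E) where
  norm_smul_le c f := by
    change ‖taylorLin (c • f)‖ ≤ ‖c‖ * ‖taylorLin f‖
    rw [map_smul, norm_smul]
  inner f g := ⟪taylorLin f, taylorLin g⟫_ℂ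
  norm_sq_eq_re_inner f := InnerProductSpace.norm_sq_eq_re_inner (𝕜 := ℂ) (taylorLin f)
  conj_inner_symm f g := inner_conj_symm (taylorLin f) (taylorLin g)
  add_left f g h := by
    change ⟪taylorLin (f + g), taylorLin h⟫_ℂ = _
    rw [map_add, inner_add_left]
  smul_left f g c := by
    change ⟪taylorLin (c • f), taylorLin g⟫_ℂ = _
    rw [map_smul, inner_smul_left]

theorem inner_eq (f g : HardySpace E) : ⟪f, g⟫_ℂ = ∑' n, ⟪f.taylor n, g.taylor n⟫_ℂ :=
  lp.inner_eq_tsum (taylorLin f) (taylorLin g)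

theorem norm_sq_eq (f : HardySpace E) : ‖f‖ ^ 2 = ∑' n, ‖f.taylor n‖ ^ 2 := by
  have h := lp.norm_rpow_eq_tsum (p := 2) (by norm_num) (taylorLin f)
  have h' : ‖taylorLin f‖ ^ 2 = ∑' n, ‖f.taylor n‖ ^ 2 := by simpa using h
  exact h'

/-- The Taylor coefficients as a linear isometry into `ℓ²(ℕ, E)`. -/
def taylorIsometry : HardySpace E →ₗᵢ[ℂ] lp (fun _ : ℕ => E) 2 :=
  ⟨taylorLin, fun _ => rfl⟩

/-- Every square summable sequence in a Hilbert space is the sequence of Taylor coefficients of an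
element of the Hardy space. -/
theorem taylorIsometry_surjective [CompleteSpace E] :
    Function.Surjective (taylorIsometry : HardySpace E → _) := by
  intro a
  have hs : Summable (fun n => ‖a n‖ ^ 2) := (memlp_iff _).1 a.2
  have hsum : ∀ z : UnitDisc, Summable (fun n : ℕ => (z : ℂ) ^ n • a n) := by
    intro z
    have hz := z.norm_lt_one
    refine Summable.of_norm_bounded
      ((summable_geometric_of_lt_one (norm_nonneg (z : ℂ)) hz).mul_left ‖a‖) (fun n => ?_)
    rw [norm_smul, norm_pow, mul_comm]
    gcongr
    exact lp.norm_apply_le_norm (by norm_num) a n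
  let f : HardySpace E := ⟨fun z => ∑' n : ℕ, (z : ℂ) ^ n • a n, a, hs, fun z => (hsum z).hasSum⟩
  have hf : IsTaylorSeq f a := fun z => (hsum z).hasSum
  exact ⟨f, Subtype.ext (taylor_eq hf)⟩

instance [CompleteSpace E] : CompleteSpace (HardySpace E) :=
  (completeSpace_congr (e := (LinearIsometryEquiv.ofSurjective taylorIsometry
    taylorIsometry_surjective).toEquiv) taylorIsometry.isometry.isUniformEmbedding).2 inferInstance

/-- The Taylor coefficients of `z ↦ z f(z)`. -/
def shiftSeq (a : ℕ → E) : ℕ → E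
  | 0 => 0
  | n + 1 => a n

theorem isTaylorSeq_shift {f : UnitDisc → E} {a : ℕ → E} (h : IsTaylorSeq f a) :
    IsTaylorSeq (fun z => (z : ℂ) • f z) (shiftSeq a) := by
  intro z
  rw [hasSum_nat_add_iff' 1 |>.symm]
  simpa [shiftSeq, pow_succ', mul_smul] using (h z).const_smul (z : ℂ)

theorem summable_shiftSeq {a : ℕ → E} (h : Summable (fun n => ‖a n‖ ^ 2)) :
    Summable (fun n => ‖shiftSeq a n‖ ^ 2) :=
  (summable_nat_add_iff 1).1 h

theorem isTaylorSeq_map (A : E →L[ℂ] F) {f : UnitDisc → E} {a : ℕ → E} (h : IsTaylorSeq f a) :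
    IsTaylorSeq (fun z => A (f z)) (fun n => A (a n)) := fun z => by
  simpa using A.hasSum (h z)

theorem norm_sq_map_le (A : E →L[ℂ] F) (x : E) : ‖A x‖ ^ 2 ≤ ‖A‖ ^ 2 * ‖x‖ ^ 2 := by
  rw [← mul_pow]
  gcongr
  exact A.le_opNorm x

theorem summable_map (A : E →L[ℂ] F) {a : ℕ → E} (h : Summable (fun n => ‖a n‖ ^ 2)) :
    Summable (fun n => ‖A (a n)‖ ^ 2) :=
  Summable.of_nonneg_of_le (fun _ => by positivity) (fun n => norm_sq_map_le A (a n))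
    (h.mul_left _)

/-- The function `z ↦ z f(z)`. -/
def shift (f : HardySpace E) : HardySpace E :=
  ⟨fun z => (z : ℂ) • f z, shiftSeq f.taylor, summable_shiftSeq f.summable_taylor,
    isTaylorSeq_shift f.isTaylorSeq_taylor⟩

theorem norm_shift (f : HardySpace E) : ‖shift f‖ = ‖f‖ := by
  rw [← sq_eq_sq₀ (norm_nonneg _) (norm_nonneg _), norm_sq_eq, norm_sq_eq,
    taylor_eq (f := shift f) (isTaylorSeq_shift f.isTaylorSeq_taylor),
    (summable_shiftSeq f.summable_taylor).tsum_eq_zero_add]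
  simp [shiftSeq]

variable (E) in
/-- The operator `M_z` on the Hardy space, `(M_z f)(z) = z f(z)`. -/
def mulZ : HardySpace E →L[ℂ] HardySpace E :=
  LinearMap.mkContinuous
    { toFun := shift
      map_add' := fun f g => ext fun z => smul_add (z : ℂ) (f z) (g z)
      map_smul' := fun c f => ext fun z => smul_comm (z : ℂ) c (f z) } 1
    (fun f => by rw [one_mul]; exact (norm_shift f).le)

@[simp] theorem mulZ_apply (f : HardySpace E) (z : UnitDisc) :
    mulZ E f z = (z : ℂ) • f z := rfl

/-- The function `z ↦ A (f(z))`. -/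
def mapFun (A : E →L[ℂ] F) (f : HardySpace E) : HardySpace F :=
  ⟨fun z => A (f z), fun n => A (f.taylor n), summable_map A f.summable_taylor,
    isTaylorSeq_map A f.isTaylorSeq_taylor⟩

theorem norm_mapFun_le (A : E →L[ℂ] F) (f : HardySpace E) : ‖mapFun A f‖ ≤ ‖A‖ * ‖f‖ := by
  rw [← sq_le_sq₀ (norm_nonneg _) (by positivity), mul_pow, norm_sq_eq, norm_sq_eq,
    taylor_eq (f := mapFun A f) (isTaylorSeq_map A f.isTaylorSeq_taylor), ← tsum_mul_left]
  exact (summable_map A f.summable_taylor).tsum_le_tsum (fun n => norm_sq_map_le A _)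
    (f.summable_taylor.mul_left _)

/-- The operator `H²_E(𝔻) → H²_F(𝔻)` induced by a bounded operator `A : E → F`,
`(A f)(z) = A (f(z))`. -/
def mapCoeff (A : E →L[ℂ] F) : HardySpace E →L[ℂ] HardySpace F :=
  LinearMap.mkContinuous
    { toFun := mapFun A
      map_add' := fun f g => ext fun z => map_add A (f z) (g z)
      map_smul' := fun c f => ext fun z => map_smul A c (f z) } ‖A‖ (norm_mapFun_le A)

@[simp] theorem mapCoeff_apply (A : E →L[ℂ] F) (f : HardySpace E) (z : UnitDisc) :
    mapCoeff A f z = A (f z) := rfl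

end HardySpace

end Hardy

/-! ### Hilbert modules over `ℂ[z₁, …, zₙ]` -/

/-- A Hilbert module structure over `ℂ[z₁, …, zₙ]` on `H`, given by the commuting bounded operators
`M₁, …, Mₙ` by which the coordinate functions act. -/
structure HilbertModule (n : ℕ) (H : Type*) [NormedAddCommGroup H] [InnerProductSpace ℂ H] where
  /-- module multiplication by the `i`-th coordinate function -/
  M : Fin n → H →L[ℂ] H
  comm : ∀ i j, M i ∘L M j = M j ∘L M i

namespace HilbertModule

variable {n : ℕ} {H : Type*} [NormedAddCommGroup H] [InnerProductSpace ℂ H]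
variable {K : Type*} [NormedAddCommGroup K] [InnerProductSpace ℂ K]

/-- A submodule of a Hilbert module is a closed subspace that is invariant under all `Mᵢ`. -/
def IsSubmodule (T : HilbertModule n H) (S : Submodule ℂ H) : Prop :=
  IsClosed (S : Set H) ∧ ∀ i, ∀ f ∈ S, T.M i f ∈ S

/-- A module map between Hilbert modules is a bounded linear map that intertwines the `Mᵢ`. -/
def IsModuleMap (T : HilbertModule n H) (R : HilbertModule n K) (X : H →L[ℂ] K) : Prop :=
  ∀ i, X ∘L T.M i = R.M i ∘L X

end HilbertModule

/-- The numerical radius `w(A) = sup {|⟪A x, x⟫| : ‖x‖ = 1}`. -/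
def numericalRadius {E : Type*} [NormedAddCommGroup E] [InnerProductSpace ℂ E]
    (A : E →L[ℂ] E) : ℝ :=
  sSup {r : ℝ | ∃ x : E, ‖x‖ = 1 ∧ r = ‖⟪A x, x⟫_ℂ‖}

/-- The Hilbert module `[H²_E(𝔻)]_A` over `ℂ[z₁, z₂]`: on the Hardy space `H²_E(𝔻)`, the coordinate
functions act by `A + A* M_z` and by `M_z`. -/
def hardyModule {E : Type*} [NormedAddCommGroup E] [InnerProductSpace ℂ E] [CompleteSpace E]
    (A : E →L[ℂ] E) : HilbertModule 2 (HardySpace E) where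
  M := ![HardySpace.mapCoeff A + HardySpace.mapCoeff (ContinuousLinearMap.adjoint A) ∘L
      HardySpace.mulZ E, HardySpace.mulZ E]
  comm := by
    intro i j
    fin_cases i <;> fin_cases j <;> ext f z <;> simp

end

/-! Write `P_A = A + A* M_z` (`pencil A`). Three facts give existence. By the Wold decomposition, a
closed `M_z`-invariant `S` is the image of the Hardy space over `S ⊖ zS` under an isometry `U`
commuting with `M_z` (`exists_linearIsometry_range_eq`). An operator `R` is a pencil as soon as it
commutes with `M_z` and satisfies `R = R* M_z` (`exists_eq_pencil`). Both relations hold for `P_A`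
and pass to `R = U* P_A U` when the range of `U` is invariant under `P_A`. Finally, `w(A) ≤ 1` if
and only if `|⟪P_A f, f⟫| ≤ 2‖f‖²` for all `f` (`norm_inner_pencil_le`,
`numericalRadius_le_one_of_pencil`), and this bound survives restriction along an isometry. Hence `R
= P_B` with `w(B) ≤ 1`.

For uniqueness, `P_B` determines `B` through its action on constants, and `U` is injective. Two
representations of `S` differ by a unitary commuting with `M_z`. It maps constants, the orthogonal
complement of the range of `M_z`, to constants, and there it conjugates one symbol into the other.
Conversely, the range of a module map is invariant. -/

noncomputable section

/-! ### Monomials and Taylor expansions in the Hardy space -/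

namespace HardySpace

variable {E : Type*} [NormedAddCommGroup E] [InnerProductSpace ℂ E]
variable {F : Type*} [NormedAddCommGroup F] [InnerProductSpace ℂ F]

omit [InnerProductSpace ℂ E] in
theorem summable_norm_sq_single (n : ℕ) (x : E) :
    Summable fun k => ‖(Pi.single n x : ℕ → E) k‖ ^ 2 :=
  summable_of_ne_finset_zero (s := {n}) fun k hk => by
    rw [Pi.single_eq_of_ne (by simpa using hk)]
    simp

theorem isTaylorSeq_single (n : ℕ) (x : E) :
    IsTaylorSeq (fun z : UnitDisc => (z : ℂ) ^ n • x) (Pi.single n x) := fun z => by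
  have h := hasSum_single (f := fun k => (z : ℂ) ^ k • (Pi.single n x : ℕ → E) k) n
    fun k hk => by rw [Pi.single_eq_of_ne hk, smul_zero]
  simpa using h

/-- The function `z ↦ zⁿ x`. -/
def monomialFun (n : ℕ) (x : E) : HardySpace E :=
  ⟨fun z => (z : ℂ) ^ n • x, Pi.single n x, summable_norm_sq_single n x, isTaylorSeq_single n x⟩

theorem taylor_monomialFun (n : ℕ) (x : E) : (monomialFun n x).taylor = Pi.single n x :=
  taylor_eq (f := monomialFun n x) (isTaylorSeq_single n x)

/-- The isometric embedding of `E` into the Hardy space by `x ↦ (z ↦ zⁿ x)`. -/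
def monomial (n : ℕ) : E →ₗᵢ[ℂ] HardySpace E where
  toFun := monomialFun n
  map_add' x y := ext fun z => smul_add ((z : ℂ) ^ n) x y
  map_smul' c x := ext fun z => smul_comm ((z : ℂ) ^ n) c x
  norm_map' x := by
    rw [← sq_eq_sq₀ (norm_nonneg _) (norm_nonneg _)]
    change ‖monomialFun n x‖ ^ 2 = _
    rw [norm_sq_eq, taylor_monomialFun, tsum_eq_single n]
    · simp
    · intro k hk
      simp [Pi.single_eq_of_ne hk]

@[simp] theorem monomial_apply (n : ℕ) (x : E) (z : UnitDisc) :
    monomial n x z = (z : ℂ) ^ n • x := rfl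

theorem taylor_monomial (n : ℕ) (x : E) : (monomial n x).taylor = Pi.single n x :=
  taylor_monomialFun n x

theorem mulZ_monomial (n : ℕ) (x : E) : mulZ E (monomial n x) = monomial (n + 1) x := by
  ext z
  simp [pow_succ', mul_smul]

theorem taylor_mulZ (f : HardySpace E) : (mulZ E f).taylor = shiftSeq f.taylor :=
  taylor_eq (f := mulZ E f) (isTaylorSeq_shift f.isTaylorSeq_taylor)

theorem taylor_mapCoeff (A : E →L[ℂ] F) (f : HardySpace E) :
    (mapCoeff A f).taylor = fun n => A (f.taylor n) :=
  taylor_eq (f := mapCoeff A f) (isTaylorSeq_map A f.isTaylorSeq_taylor)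

theorem mapCoeff_monomial (A : E →L[ℂ] F) (n : ℕ) (x : E) :
    mapCoeff A (monomial n x) = monomial n (A x) := by
  ext z
  simp

theorem mapCoeff_mulZ (A : E →L[ℂ] F) (f : HardySpace E) :
    mapCoeff A (mulZ E f) = mulZ F (mapCoeff A f) := by
  ext z
  simp

theorem norm_mulZ (f : HardySpace E) : ‖mulZ E f‖ = ‖f‖ := norm_shift f

variable (E) in
/-- Multiplication by `z` as a linear isometry. -/
def mulZIsometry : HardySpace E →ₗᵢ[ℂ] HardySpace E :=
  ⟨(mulZ E).toLinearMap, norm_mulZ⟩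

theorem inner_mulZ_mulZ (f g : HardySpace E) : ⟪mulZ E f, mulZ E g⟫_ℂ = ⟪f, g⟫_ℂ :=
  (mulZIsometry E).inner_map_map f g

theorem inner_monomial_left (n : ℕ) (x : E) (f : HardySpace E) :
    ⟪monomial n x, f⟫_ℂ = ⟪x, f.taylor n⟫_ℂ := by
  rw [inner_eq, taylor_monomial, tsum_eq_single n]
  · simp
  · intro k hk
    simp [Pi.single_eq_of_ne hk]

theorem inner_monomial_zero_mulZ (x : E) (f : HardySpace E) :
    ⟪monomial 0 x, mulZ E f⟫_ℂ = 0 := by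
  rw [inner_monomial_left, taylor_mulZ]
  exact inner_zero_right x

theorem inner_mulZ_monomial_zero (x : E) (f : HardySpace E) :
    ⟪mulZ E f, monomial 0 x⟫_ℂ = 0 := by
  rw [← inner_conj_symm, inner_monomial_zero_mulZ, map_zero]

theorem ext_taylor {f g : HardySpace E} (h : f.taylor = g.taylor) : f = g :=
  taylorLin_injective (Subtype.ext h)

theorem ext_inner_monomial {f g : HardySpace E}
    (h : ∀ n (x : E), ⟪monomial n x, f⟫_ℂ = ⟪monomial n x, g⟫_ℂ) : f = g := by
  refine ext_taylor (funext fun n => ext_inner_left ℂ fun x => ?_)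
  rw [← inner_monomial_left, ← inner_monomial_left, h]

theorem taylorLin_monomial (n : ℕ) (x : E) : taylorLin (monomial n x) = lp.single 2 n x :=
  Subtype.ext (taylor_monomial n x)

theorem hasSum_monomial (f : HardySpace E) : HasSum (fun n => monomial n (f.taylor n)) f := by
  have h := lp.hasSum_single (p := 2) (by norm_num) (taylorLin f)
  have hi : IsInducing (taylorLin : HardySpace E → _) :=
    (taylorIsometry (E := E)).isometry.isUniformInducing.isInducing
  rw [← hi.hasSum_iff (g := (taylorLin : HardySpace E →ₗ[ℂ] _))]
  convert h using 2 with n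
  exact taylorLin_monomial n _

theorem clm_ext {G : Type*} [NormedAddCommGroup G] [NormedSpace ℂ G]
    {X Y : HardySpace E →L[ℂ] G} (h : ∀ n x, X (monomial n x) = Y (monomial n x)) : X = Y := by
  ext f
  have hX := X.hasSum (hasSum_monomial f)
  have hY := Y.hasSum (hasSum_monomial f)
  simp only [h] at hX
  exact hX.unique hY

/-- Intertwiners of the multiplications by `z` are determined by their values at constants. -/
theorem clm_ext_of_comm {V : F →L[ℂ] F} {X Y : HardySpace E →L[ℂ] F}
    (hX : ∀ f, X (mulZ E f) = V (X f)) (hY : ∀ f, Y (mulZ E f) = V (Y f))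
    (h : ∀ x, X (monomial 0 x) = Y (monomial 0 x)) : X = Y := by
  refine clm_ext fun n x => ?_
  induction n with
  | zero => exact h x
  | succ n ih => rw [← mulZ_monomial, hX, hY, ih]

/-- A function that is orthogonal to the range of `M_z` is constant. -/
theorem eq_monomial_zero {f : HardySpace E} (h : ∀ g, ⟪mulZ E g, f⟫_ℂ = 0) :
    f = monomial 0 (f 0) := by
  have key : ∀ n, f.taylor (n + 1) = 0 := fun n => by
    refine ext_inner_left ℂ fun x => ?_
    rw [← inner_monomial_left, ← mulZ_monomial, h, inner_zero_right]
  have h0 : f = monomial 0 (f.taylor 0) := by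
    refine ext_taylor (funext fun n => ?_)
    rw [taylor_monomial]
    cases n with
    | zero => simp
    | succ n => rw [key, Pi.single_eq_of_ne (by simp)]
  rw [h0, monomial_apply]
  simp

/-- Partial Taylor sums lie in the span of countably many separable sets. This makes the wandering
subspace an admissible separable coefficient space. -/
instance separableSpace [TopologicalSpace.SeparableSpace E] :
    TopologicalSpace.SeparableSpace (HardySpace E) := by
  have h1 : TopologicalSpace.IsSeparable
      (⋃ n, Set.range (monomial n : E → HardySpace E)) :=
    TopologicalSpace.IsSeparable.iUnion fun n =>
      TopologicalSpace.isSeparable_range (monomial n).continuous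
  have h2 := (h1.span (R := ℂ)).closure
  refine TopologicalSpace.isSeparable_univ_iff.1 (h2.mono fun f _ => ?_)
  refine mem_closure_of_tendsto (hasSum_monomial f) (Filter.Eventually.of_forall fun s => ?_)
  exact Submodule.sum_mem _ fun n _ => Submodule.subset_span (Set.mem_iUnion.2 ⟨n, _, rfl⟩)

end HardySpace

/-! ### The numerical radius as a quadratic form bound -/

section NumericalRadius

variable {E : Type*} [NormedAddCommGroup E] [InnerProductSpace ℂ E]

theorem norm_inner_le_of_numericalRadius_le_one {A : E →L[ℂ] E} (hA : numericalRadius A ≤ 1)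
    (x : E) : ‖⟪A x, x⟫_ℂ‖ ≤ ‖x‖ ^ 2 := by
  -- The real `sSup` of an unbounded set is `0`, so boundedness must be known before the supremum
  -- bounds anything.
  have hbdd : BddAbove {r : ℝ | ∃ x : E, ‖x‖ = 1 ∧ r = ‖⟪A x, x⟫_ℂ‖} := by
    refine ⟨‖A‖, ?_⟩
    rintro r ⟨y, hy, rfl⟩
    have h := (norm_inner_le_norm (𝕜 := ℂ) (A y) y).trans
      (mul_le_mul_of_nonneg_right (A.le_opNorm y) (norm_nonneg y))
    simpa [hy] using h
  by_cases hx : x = 0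
  · simp [hx]
  have hx' : ‖x‖ ≠ 0 := norm_ne_zero_iff.2 hx
  have h1 : ‖⟪A (((‖x‖ : ℂ)⁻¹) • x), ((‖x‖ : ℂ)⁻¹) • x⟫_ℂ‖ ≤ 1 := by
    refine (le_csSup hbdd ⟨_, ?_, rfl⟩).trans hA
    rw [norm_smul]
    simp [hx']
  rw [map_smul, inner_smul_left, inner_smul_right, norm_mul, norm_mul] at h1
  simp only [map_inv₀, conj_ofReal, norm_inv, norm_real, norm_norm] at h1
  field_simp at h1
  exact h1

theorem numericalRadius_le_one {A : E →L[ℂ] E}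
    (h : ∀ x : E, ‖x‖ = 1 → ‖⟪A x, x⟫_ℂ‖ ≤ 1) : numericalRadius A ≤ 1 := by
  -- `zero_le_one` covers the zero space, where the set is empty and its `sSup` is `0`.
  refine Real.sSup_le ?_ zero_le_one
  rintro r ⟨x, hx, rfl⟩
  exact h x hx

end NumericalRadius

/-! ### Fourier averaging over roots of unity -/

section RootsOfUnity

variable {E : Type*} [NormedAddCommGroup E] [InnerProductSpace ℂ E]

/-- Orthogonality of characters: `conj ζ = ζ⁻¹`, and for `i ≠ j` below `M` the ratio `ζ ^ (j - i)`
is a nontrivial `M`-th root of unity, so its geometric sum vanishes. -/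
theorem IsPrimitiveRoot.sum_conj_pow_mul_pow {M : ℕ} {ζ : ℂ} (hζ : IsPrimitiveRoot ζ M)
    {i j : ℕ} (hi : i < M) (hj : j < M) :
    ∑ k ∈ Finset.range M, ((starRingEnd ℂ ζ) ^ i * ζ ^ j) ^ k = if j = i then (M : ℂ) else 0 := by
  have hM : M ≠ 0 := by omega
  have hc : starRingEnd ℂ ζ * ζ = 1 := by
    rw [← Complex.normSq_eq_conj_mul_self, Complex.normSq_eq_norm_sq,
      Complex.norm_eq_one_of_pow_eq_one hζ.pow_eq_one hM]
    simp
  have hci : (starRingEnd ℂ ζ) ^ i * ζ ^ i = 1 := by rw [← mul_pow, hc, one_pow]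
  split_ifs with h
  · subst h
    simp [hci]
  · have hw : (starRingEnd ℂ ζ) ^ i * ζ ^ j ≠ 1 := fun hw => h (hζ.pow_inj hj hi <| by
      calc ζ ^ j = ((starRingEnd ℂ ζ) ^ i * ζ ^ i) * ζ ^ j := by rw [hci, one_mul]
        _ = ((starRingEnd ℂ ζ) ^ i * ζ ^ j) * ζ ^ i := by ring
        _ = ζ ^ i := by rw [hw, one_mul])
    have hwM : ((starRingEnd ℂ ζ) ^ i * ζ ^ j) ^ M = 1 := by
      rw [mul_pow, ← pow_mul, ← pow_mul, mul_comm i, mul_comm j, pow_mul, pow_mul, ← map_pow,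
        hζ.pow_eq_one]
      simp
    rw [geom_sum_eq hw, hwM]
    simp

/-- The sum over the `M`-th roots of unity of `conj(ω)ˢ ⟪g(ω), A g(ω)⟫` for the polynomial
`g(ω) = ∑ ωⁿ aₙ`. -/
theorem IsPrimitiveRoot.sum_inner_eval {M N s : ℕ} {ζ : ℂ} (hζ : IsPrimitiveRoot ζ M)
    (hN : N + s < M) (A : E →L[ℂ] E) (a : ℕ → E) :
    ∑ k ∈ Finset.range M, ((starRingEnd ℂ ζ) ^ s) ^ k *
      ⟪∑ n ∈ Finset.range (N + 1), (ζ ^ n) ^ k • a n,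
        A (∑ n ∈ Finset.range (N + 1), (ζ ^ n) ^ k • a n)⟫_ℂ =
    M * ∑ n ∈ Finset.range (N + 1), ∑ m ∈ Finset.range (N + 1),
      if m = n + s then ⟪a n, A (a m)⟫_ℂ else 0 := by
  have h1 : ∀ k, ((starRingEnd ℂ ζ) ^ s) ^ k *
      ⟪∑ n ∈ Finset.range (N + 1), (ζ ^ n) ^ k • a n,
        A (∑ n ∈ Finset.range (N + 1), (ζ ^ n) ^ k • a n)⟫_ℂ =
      ∑ n ∈ Finset.range (N + 1), ∑ m ∈ Finset.range (N + 1),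
        ((starRingEnd ℂ ζ) ^ (n + s) * ζ ^ m) ^ k * ⟪a n, A (a m)⟫_ℂ := fun k => by
    rw [sum_inner, Finset.mul_sum]
    refine Finset.sum_congr rfl fun n _ => ?_
    rw [map_sum, inner_sum, Finset.mul_sum]
    refine Finset.sum_congr rfl fun m _ => ?_
    rw [map_smul, inner_smul_left, inner_smul_right]
    simp only [map_pow]
    ring
  rw [Finset.sum_congr rfl fun k _ => h1 k, Finset.sum_comm, Finset.mul_sum]
  refine Finset.sum_congr rfl fun n hn => ?_
  rw [Finset.sum_comm, Finset.mul_sum]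
  refine Finset.sum_congr rfl fun m hm => ?_
  rw [Finset.mem_range] at hn hm
  -- Since `N + s < M`, the exponents `n + s` and `m` agree modulo `M` only if they are equal.
  rw [← Finset.sum_mul, hζ.sum_conj_pow_mul_pow (by omega) (by omega)]
  split_ifs <;> simp

/-- The sum is the first Fourier coefficient of `ω ↦ ⟪g(ω), A g(ω)⟫` for `g(ω) = ∑ ωⁿ aₙ`. The
hypothesis bounds this function by `‖g(ω)‖²`, whose mean is `∑ ‖aₙ‖²`. Averaging avoids the operator
norm of `A`, for which only `‖A‖ ≤ 2` is available. -/
theorem norm_sum_inner_succ_le {A : E →L[ℂ] E} (hA : ∀ x, ‖⟪A x, x⟫_ℂ‖ ≤ ‖x‖ ^ 2)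
    (a : ℕ → E) (N : ℕ) :
    ‖∑ n ∈ Finset.range N, ⟪a n, A (a (n + 1))⟫_ℂ‖ ≤ ∑ n ∈ Finset.range (N + 1), ‖a n‖ ^ 2 := by
  -- The order `N + 2` is the least one exceeding the degree `N` plus the frequency `1`.
  have hζ := Complex.isPrimitiveRoot_exp (N + 2) (by omega)
  set ζ := Complex.exp (2 * Real.pi * I / ((N + 2 : ℕ) : ℂ))
  have hζ1 : ‖ζ‖ = 1 := Complex.norm_eq_one_of_pow_eq_one hζ.pow_eq_one (by omega)
  set g : ℕ → E := fun k => ∑ n ∈ Finset.range (N + 1), (ζ ^ n) ^ k • a n with hg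
  have h1 : ∑ k ∈ Finset.range (N + 2), ((starRingEnd ℂ ζ) ^ 1) ^ k * ⟪g k, A (g k)⟫_ℂ =
      (N + 2 : ℕ) * ∑ n ∈ Finset.range N, ⟪a n, A (a (n + 1))⟫_ℂ := by
    rw [hζ.sum_inner_eval (N := N) (s := 1) (by omega), Finset.sum_range_succ]
    congr 1
    -- The top index `n = N` has no partner `m = N + 1`.
    have h2 : ∑ m ∈ Finset.range (N + 1),
        (if m = N + 1 then ⟪a N, A (a m)⟫_ℂ else 0) = 0 :=
      Finset.sum_eq_zero fun m hm => if_neg (by rw [Finset.mem_range] at hm; omega)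
    rw [h2, add_zero]
    refine Finset.sum_congr rfl fun n hn => ?_
    rw [Finset.mem_range] at hn
    rw [Finset.sum_ite_eq', if_pos (by rw [Finset.mem_range]; omega)]
  have h2 : ∑ k ∈ Finset.range (N + 2), ‖g k‖ ^ 2 =
      (N + 2 : ℕ) * ∑ n ∈ Finset.range (N + 1), ‖a n‖ ^ 2 := by
    -- Frequency `0` and the identity operator give Parseval's identity.
    have h := hζ.sum_inner_eval (N := N) (s := 0) (by omega) (ContinuousLinearMap.id ℂ E) a
    simp only [pow_zero, one_pow, one_mul, add_zero, ContinuousLinearMap.id_apply,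
      inner_self_eq_norm_sq_to_K, Finset.sum_ite_eq', Finset.sum_ite_mem,
      Finset.inter_self] at h
    apply Complex.ofReal_injective
    push_cast at h ⊢
    exact h
  have h3 : ‖∑ k ∈ Finset.range (N + 2), ((starRingEnd ℂ ζ) ^ 1) ^ k * ⟪g k, A (g k)⟫_ℂ‖ ≤
      ∑ k ∈ Finset.range (N + 2), ‖g k‖ ^ 2 := by
    refine norm_sum_le_of_le _ fun k _ => ?_
    rw [norm_mul, norm_pow, norm_pow, RCLike.norm_conj, hζ1, one_pow, one_pow, one_mul,
      norm_inner_symm]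
    exact hA _
  rw [h1, h2, norm_mul, Complex.norm_natCast] at h3
  exact le_of_mul_le_mul_left h3 (by positivity)

end RootsOfUnity

/-! ### The pencil `A + A* M_z`: quadratic form bound and characterization -/

namespace HardySpace

variable {E : Type*} [NormedAddCommGroup E] [InnerProductSpace ℂ E] [CompleteSpace E]

/-- The operator `A + A* M_z` on the Hardy space. -/
def pencil (A : E →L[ℂ] E) : HardySpace E →L[ℂ] HardySpace E :=
  mapCoeff A + mapCoeff (ContinuousLinearMap.adjoint A) ∘L mulZ E

theorem pencil_apply (A : E →L[ℂ] E) (f : HardySpace E) :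
    pencil A f = mapCoeff A f + mapCoeff (ContinuousLinearMap.adjoint A) (mulZ E f) := rfl

theorem pencil_mulZ (A : E →L[ℂ] E) (f : HardySpace E) :
    pencil A (mulZ E f) = mulZ E (pencil A f) := by
  simp only [pencil_apply, mapCoeff_mulZ, map_add]

theorem pencil_monomial_zero (A : E →L[ℂ] E) (x : E) :
    pencil A (monomial 0 x) =
      monomial 0 (A x) + mulZ E (monomial 0 (ContinuousLinearMap.adjoint A x)) := by
  rw [pencil_apply, mapCoeff_mulZ, mapCoeff_monomial, mapCoeff_monomial]

omit [CompleteSpace E] in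
theorem hasSum_inner (f g : HardySpace E) :
    HasSum (fun n => ⟪f.taylor n, g.taylor n⟫_ℂ) ⟪f, g⟫_ℂ :=
  lp.hasSum_inner (taylorLin f) (taylorLin g)

theorem inner_mapCoeff_left (A : E →L[ℂ] E) (f g : HardySpace E) :
    ⟪mapCoeff A f, g⟫_ℂ = ⟪f, mapCoeff (ContinuousLinearMap.adjoint A) g⟫_ℂ := by
  simp only [inner_eq, taylor_mapCoeff, ContinuousLinearMap.adjoint_inner_right]

/-- This is `P = P* M_z` in weak form. Moving coefficients to the other side and using that `M_z` is
isometric, the two summands of the pencil trade places. -/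
theorem inner_pencil_left (A : E →L[ℂ] E) (f g : HardySpace E) :
    ⟪pencil A f, g⟫_ℂ = ⟪mulZ E f, pencil A g⟫_ℂ := by
  simp only [pencil_apply, inner_add_left, inner_add_right, inner_mapCoeff_left,
    ContinuousLinearMap.adjoint_adjoint, mapCoeff_mulZ _ g, inner_mulZ_mulZ]
  ring

theorem hasSum_inner_pencil (A : E →L[ℂ] E) (f : HardySpace E) :
    HasSum (fun n => ⟪A (f.taylor n), f.taylor n⟫_ℂ + ⟪f.taylor n, A (f.taylor (n + 1))⟫_ℂ)
      ⟪pencil A f, f⟫_ℂ := by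
  have h1 := hasSum_inner (mapCoeff A f) f
  have h2 := hasSum_inner (mulZ E f) (mapCoeff A f)
  rw [taylor_mapCoeff] at h1
  -- The zeroth coefficient of `z f` vanishes; dropping it pairs `aₙ` with `A aₙ₊₁`.
  rw [taylor_mulZ, taylor_mapCoeff, ← hasSum_nat_add_iff' 1] at h2
  simp only [Finset.sum_range_one, shiftSeq, inner_zero_left, sub_zero] at h2
  rw [pencil_apply, inner_add_left, inner_mapCoeff_left _ (mulZ E f),
    ContinuousLinearMap.adjoint_adjoint]
  exact h1.add h2

/-- The diagonal and the off-diagonal terms contribute at most `‖f‖²` each. -/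
theorem norm_inner_pencil_le {A : E →L[ℂ] E} (hA : numericalRadius A ≤ 1) (f : HardySpace E) :
    ‖⟪pencil A f, f⟫_ℂ‖ ≤ 2 * ‖f‖ ^ 2 := by
  have hA' := norm_inner_le_of_numericalRadius_le_one hA
  refine le_of_tendsto (hasSum_inner_pencil A f).tendsto_sum_nat.norm
    (Filter.Eventually.of_forall fun N => ?_)
  have hle : ∀ n, ∑ k ∈ Finset.range n, ‖f.taylor k‖ ^ 2 ≤ ‖f‖ ^ 2 := fun n => by
    rw [norm_sq_eq]
    exact f.summable_taylor.sum_le_tsum _ fun _ _ => by positivity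
  rw [Finset.sum_add_distrib, two_mul]
  exact (norm_add_le _ _).trans (add_le_add
    ((norm_sum_le_of_le _ fun n _ => hA' _).trans (hle N))
    ((norm_sum_inner_succ_le hA' _ N).trans (hle (N + 1))))

/-- The polynomial `∑_{n < N} cⁿ zⁿ x`. -/
def geomPoly (c : ℂ) (x : E) (N : ℕ) : HardySpace E :=
  ∑ n ∈ Finset.range N, monomial n (c ^ n • x)

omit [CompleteSpace E] in
theorem taylor_geomPoly (c : ℂ) (x : E) (N k : ℕ) :
    (geomPoly c x N).taylor k = if k < N then c ^ k • x else 0 := by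
  refine ext_inner_left ℂ fun y => ?_
  rw [← inner_monomial_left, geomPoly, inner_sum]
  simp only [inner_monomial_left, taylor_monomial, Pi.single_apply]
  split_ifs with h
  · rw [Finset.sum_eq_single k] <;> simp +contextual [h, eq_comm, inner_smul_right]
  · rw [inner_zero_right]
    refine Finset.sum_eq_zero fun n hn => ?_
    rw [Finset.mem_range] at hn
    rw [if_neg (by omega), inner_zero_right]

omit [CompleteSpace E] in
theorem norm_geomPoly_sq {c : ℂ} (hc : ‖c‖ = 1) {x : E} (hx : ‖x‖ = 1) (N : ℕ) :
    ‖geomPoly c x N‖ ^ 2 = N := by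
  rw [norm_sq_eq, tsum_eq_sum (s := Finset.range N)]
  · rw [Finset.sum_congr rfl (g := fun _ => (1 : ℝ))]
    · simp
    · intro n hn
      rw [taylor_geomPoly, if_pos (Finset.mem_range.1 hn), norm_smul, norm_pow, hc, hx]
      simp
  · intro n hn
    rw [taylor_geomPoly, if_neg (by simpa using hn)]
    simp

theorem inner_pencil_geomPoly (B : E →L[ℂ] E) {c : ℂ} (hc : ‖c‖ = 1) (x : E) (N : ℕ) :
    ⟪pencil B (geomPoly c x (N + 1)), geomPoly c x (N + 1)⟫_ℂ =
      (N + 1) * ⟪B x, x⟫_ℂ + N * (c * ⟪x, B x⟫_ℂ) := by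
  have hcc : starRingEnd ℂ c * c = 1 := by
    rw [← Complex.normSq_eq_conj_mul_self, Complex.normSq_eq_norm_sq, hc]
    simp
  have hcn : ∀ n, (starRingEnd ℂ c) ^ n * c ^ n = 1 := fun n => by
    rw [← mul_pow, hcc, one_pow]
  rw [← (hasSum_inner_pencil B _).tsum_eq, tsum_eq_sum (s := Finset.range (N + 1))]
  · have h1 : ∀ n ∈ Finset.range (N + 1),
        ⟪B ((geomPoly c x (N + 1)).taylor n), (geomPoly c x (N + 1)).taylor n⟫_ℂ = ⟪B x, x⟫_ℂ := by
      intro n hn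
      rw [taylor_geomPoly, if_pos (Finset.mem_range.1 hn), map_smul, inner_smul_left,
        inner_smul_right, map_pow, ← mul_assoc, hcn, one_mul]
    have h2 : ∀ n ∈ Finset.range N, ⟪(geomPoly c x (N + 1)).taylor n,
        B ((geomPoly c x (N + 1)).taylor (n + 1))⟫_ℂ = c * ⟪x, B x⟫_ℂ := by
      intro n hn
      rw [Finset.mem_range] at hn
      rw [taylor_geomPoly, taylor_geomPoly, if_pos (by omega), if_pos (by omega), map_smul,
        inner_smul_left, inner_smul_right, map_pow, ← mul_assoc, pow_succ, ← mul_assoc, hcn,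
        one_mul]
    -- The last off-diagonal term vanishes, which leaves `N` of them against `N + 1` diagonal ones.
    have h3 : (geomPoly c x (N + 1)).taylor (N + 1) = 0 := by
      rw [taylor_geomPoly, if_neg (lt_irrefl _)]
    rw [Finset.sum_add_distrib, Finset.sum_congr rfl h1, Finset.sum_range_succ (fun n => ⟪_, B _⟫_ℂ),
      Finset.sum_congr rfl h2, h3]
    simp
  · intro n hn
    have hn' : ¬ n < N + 1 := by simpa using hn
    simp [taylor_geomPoly, hn']

/-- Test on `∑_{n ≤ N} cⁿ zⁿ x`, with the unimodular `c` chosen so that diagonal and off-diagonal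
terms are equal. This gives `(2N + 1) |⟪B x, x⟫| ≤ 2(N + 1)`; let `N` grow. -/
theorem numericalRadius_le_one_of_pencil {B : E →L[ℂ] E}
    (h : ∀ f, ‖⟪pencil B f, f⟫_ℂ‖ ≤ 2 * ‖f‖ ^ 2) : numericalRadius B ≤ 1 := by
  refine numericalRadius_le_one fun x hx => ?_
  obtain ⟨c, hc, hcb⟩ : ∃ c : ℂ, ‖c‖ = 1 ∧ c * ⟪x, B x⟫_ℂ = ⟪B x, x⟫_ℂ := by
    by_cases hb : ⟪x, B x⟫_ℂ = 0
    · exact ⟨1, by simp, by rw [hb, inner_eq_zero_symm.1 hb, mul_zero]⟩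
    · refine ⟨⟪B x, x⟫_ℂ / ⟪x, B x⟫_ℂ, ?_, div_mul_cancel₀ _ hb⟩
      rw [norm_div, norm_inner_symm, div_self (norm_ne_zero_iff.2 hb)]
  have key : ∀ N : ℕ, (2 * N + 1) * ‖⟪B x, x⟫_ℂ‖ ≤ 2 * (N + 1) := fun N => by
    have h1 := h (geomPoly c x (N + 1))
    rw [inner_pencil_geomPoly B hc, hcb, norm_geomPoly_sq hc hx, ← add_mul, norm_mul] at h1
    have h2 : ‖((N : ℂ) + 1 + N)‖ = 2 * N + 1 := by
      have : ((N : ℂ) + 1 + N) = ((2 * N + 1 : ℕ) : ℂ) := by push_cast; ring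
      rw [this, Complex.norm_natCast]
      push_cast
      ring
    rw [h2] at h1
    exact_mod_cast h1
  by_contra! hlt
  -- With `r = ‖⟪B x, x⟫‖`, `key N` says `(2N + 1)(r - 1) ≤ 1`, which fails once `N (r - 1) > 1`.
  obtain ⟨N, hN⟩ := exists_nat_gt (1 / (‖⟪B x, x⟫_ℂ‖ - 1))
  rw [div_lt_iff₀ (by linarith)] at hN
  nlinarith [key N]

/-- An operator `R` that commutes with `M_z` and satisfies `R = R* M_z` is of the form
`B + B* M_z`. -/
theorem exists_eq_pencil {R : HardySpace E →L[ℂ] HardySpace E}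
    (hR : ∀ f, R (mulZ E f) = mulZ E (R f))
    (hR' : ∀ f g, ⟪R f, g⟫_ℂ = ⟪mulZ E f, R g⟫_ℂ) : ∃ B : E →L[ℂ] E, R = pencil B := by
  let J : E →L[ℂ] HardySpace E := (monomial 0).toContinuousLinearMap
  -- The symbol is the compression of `R` to the constants.
  let B : E →L[ℂ] E := ContinuousLinearMap.adjoint J ∘L R ∘L J
  have hB : ∀ x y : E, ⟪y, B x⟫_ℂ = ⟪monomial 0 y, R (monomial 0 x)⟫_ℂ := fun x y =>
    ContinuousLinearMap.adjoint_inner_right J y (R (J x))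
  have hR'' : ∀ f g, ⟪f, R g⟫_ℂ = ⟪R f, mulZ E g⟫_ℂ := fun f g => by
    rw [← inner_conj_symm, hR', inner_conj_symm]
  refine ⟨B, clm_ext_of_comm hR (pencil_mulZ B) fun x => ext_inner_monomial fun n y => ?_⟩
  rw [pencil_monomial_zero, inner_add_right]
  cases n with
  | zero =>
    rw [inner_monomial_zero_mulZ, add_zero, LinearIsometry.inner_map_map, hB]
  | succ n =>
    -- By `hR'`, coefficient `n + 1` of `R x` is read off from `⟪R (zⁿ y), x⟫`. This yields `B*` for
    -- `n = 0`; for `n > 0` it vanishes, because `R (zⁿ y)` is then divisible by `z`.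
    rw [← mulZ_monomial, inner_mulZ_monomial_zero, zero_add, inner_mulZ_mulZ, ← hR']
    cases n with
    | zero =>
      rw [LinearIsometry.inner_map_map, ContinuousLinearMap.adjoint_inner_right,
        ← inner_conj_symm, ← hB, inner_conj_symm]
    | succ n =>
      rw [← mulZ_monomial, hR, inner_mulZ_monomial_zero, inner_mulZ_monomial_zero]

/-! ### Wold decomposition of invariant subspaces -/

section Wold

variable {F : Type*} [NormedAddCommGroup F] [InnerProductSpace ℂ F]

/-- The wandering subspace `S ⊖ zS` of a subspace `S` of the Hardy space. -/
def wandering (S : Submodule ℂ (HardySpace F)) : Submodule ℂ (HardySpace F) :=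
  S ⊓ (S.map (mulZIsometry F).toLinearMap)ᗮ

/-- The isometric embedding `f ↦ zⁿ f` of the wandering subspace. -/
def wanderingEmb (S : Submodule ℂ (HardySpace F)) (n : ℕ) :
    wandering S →ₗᵢ[ℂ] HardySpace F :=
  (mulZIsometry F ^ n).comp (wandering S).subtypeₗᵢ

theorem wanderingEmb_succ (S : Submodule ℂ (HardySpace F)) (n : ℕ) (w : wandering S) :
    wanderingEmb S (n + 1) w = mulZ F (wanderingEmb S n w) := by
  simp only [wanderingEmb, pow_succ']
  rfl

variable {S : Submodule ℂ (HardySpace F)}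

theorem wanderingEmb_mem (hS : ∀ f ∈ S, mulZ F f ∈ S) (n : ℕ) (w : wandering S) :
    wanderingEmb S n w ∈ S := by
  induction n with
  | zero => exact w.2.1
  | succ n ih => exact wanderingEmb_succ S n w ▸ hS _ ih

theorem inner_mulZ_of_mem_wandering {f g : HardySpace F} (hf : f ∈ wandering S) (hg : g ∈ S) :
    ⟪f, mulZ F g⟫_ℂ = 0 :=
  Submodule.inner_left_of_mem_orthogonal (Submodule.mem_map_of_mem hg) hf.2

/-- Cancelling the common power of `z` leaves a wandering vector paired with an element of `zS`. -/
theorem inner_wanderingEmb_of_lt (hS : ∀ f ∈ S, mulZ F f ∈ S) {i j : ℕ} (hij : i < j)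
    (v w : wandering S) : ⟪wanderingEmb S i v, wanderingEmb S j w⟫_ℂ = 0 := by
  induction i generalizing j with
  | zero =>
    obtain ⟨j, rfl⟩ := Nat.exists_eq_succ_of_ne_zero hij.ne'
    rw [Nat.succ_eq_add_one, wanderingEmb_succ]
    exact inner_mulZ_of_mem_wandering v.2 (wanderingEmb_mem hS j w)
  | succ i ih =>
    obtain ⟨j, rfl⟩ := Nat.exists_eq_succ_of_ne_zero (Nat.ne_zero_of_lt hij)
    rw [Nat.succ_eq_add_one, wanderingEmb_succ, wanderingEmb_succ, inner_mulZ_mulZ]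
    exact ih (Nat.lt_of_succ_lt_succ hij)

theorem orthogonalFamily_wanderingEmb (hS : ∀ f ∈ S, mulZ F f ∈ S) :
    OrthogonalFamily ℂ (fun _ : ℕ => wandering S) (wanderingEmb S) := by
  intro i j hij v w
  rcases lt_or_gt_of_ne hij with h | h
  · exact inner_wanderingEmb_of_lt hS h v w
  · exact inner_eq_zero_symm.1 (inner_wanderingEmb_of_lt hS h w v)

variable [CompleteSpace F]

theorem exists_eq_mulZ_of_orthogonal_wandering (hSc : IsClosed (S : Set (HardySpace F)))
    (hS : ∀ f ∈ S, mulZ F f ∈ S) {q : HardySpace F} (hq : q ∈ S)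
    (hqw : ∀ w ∈ wandering S, ⟪w, q⟫_ℂ = 0) : ∃ g ∈ S, mulZ F g = q := by
  have : CompleteSpace S := hSc.completeSpace_coe
  have : CompleteSpace (S.map (mulZIsometry F).toLinearMap) :=
    (mulZIsometry F).completeSpace_map S
  obtain ⟨p, ⟨g, hg, hgp⟩, hr⟩ := Submodule.HasOrthogonalProjection.exists_orthogonal
    (K := S.map (mulZIsometry F).toLinearMap) q
  obtain rfl : mulZ F g = p := hgp
  have hw : q - mulZ F g ∈ wandering S := ⟨S.sub_mem hq (hS g hg), hr⟩
  -- The residual of projecting `q` onto `zS` is wandering, hence orthogonal to both `q` and `z g`,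
  -- and so to itself.
  have h3 : ⟪q - mulZ F g, q - mulZ F g⟫_ℂ = 0 := by
    rw [inner_sub_right, hqw _ hw, inner_mulZ_of_mem_wandering hw hg, sub_zero]
  exact ⟨g, hg, (sub_eq_zero.1 (inner_self_eq_zero.1 h3)).symm⟩

/-- The shift has no unitary part: such a `q` equals `z g` with `g ∈ S` subject to the same
orthogonality, so `q` is divisible by every power of `z`. -/
theorem eq_zero_of_orthogonal_wanderingEmb (hSc : IsClosed (S : Set (HardySpace F)))
    (hS : ∀ f ∈ S, mulZ F f ∈ S) {q : HardySpace F} (hq : q ∈ S)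
    (hqw : ∀ n w, ⟪wanderingEmb S n w, q⟫_ℂ = 0) : q = 0 := by
  have key : ∀ n, ∀ q ∈ S, (∀ n w, ⟪wanderingEmb S n w, q⟫_ℂ = 0) → q.taylor n = 0 := by
    intro n
    induction n with
    | zero =>
      intro q hq hqw
      obtain ⟨g, -, rfl⟩ := exists_eq_mulZ_of_orthogonal_wandering hSc hS hq
        fun w hw => hqw 0 ⟨w, hw⟩
      rw [taylor_mulZ, shiftSeq]
    | succ n ih =>
      intro q hq hqw
      obtain ⟨g, hg, rfl⟩ := exists_eq_mulZ_of_orthogonal_wandering hSc hS hq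
        fun w hw => hqw 0 ⟨w, hw⟩
      rw [taylor_mulZ, shiftSeq]
      refine ih g hg fun m w => ?_
      rw [← inner_mulZ_mulZ, ← wanderingEmb_succ, hqw]
  refine ext_inner_monomial fun n x => ?_
  rw [inner_monomial_left, key n q hq hqw, inner_zero_right, inner_zero_right]

theorem topologicalClosure_iSup_wanderingEmb (hSc : IsClosed (S : Set (HardySpace F)))
    (hS : ∀ f ∈ S, mulZ F f ∈ S) :
    (⨆ n, LinearMap.range (wanderingEmb S n).toLinearMap).topologicalClosure = S := by
  set L := (⨆ n, LinearMap.range (wanderingEmb S n).toLinearMap).topologicalClosure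
  have hLS : L ≤ S := by
    refine Submodule.topologicalClosure_minimal _ (iSup_le fun n => ?_) hSc
    rintro _ ⟨w, rfl⟩
    exact wanderingEmb_mem hS n w
  refine le_antisymm hLS fun f hf => ?_
  have : CompleteSpace L := (Submodule.isClosed_topologicalClosure _).completeSpace_coe
  obtain ⟨p, hp, hr⟩ := Submodule.HasOrthogonalProjection.exists_orthogonal (K := L) f
  have h0 := eq_zero_of_orthogonal_wanderingEmb hSc hS (S.sub_mem hf (hLS hp)) fun n w =>
    Submodule.inner_right_of_mem_orthogonal (Submodule.le_topologicalClosure _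
      (Submodule.mem_iSup_of_mem n (LinearMap.mem_range_self _ w))) hr
  rwa [sub_eq_zero.1 h0]

omit [CompleteSpace F] in
theorem isClosed_wandering (hSc : IsClosed (S : Set (HardySpace F))) :
    IsClosed (wandering S : Set (HardySpace F)) :=
  hSc.inter (Submodule.isClosed_orthogonal _)

/-- The Wold decomposition of the restriction of `M_z` to a closed invariant subspace. -/
theorem exists_linearIsometry_range_eq (hSc : IsClosed (S : Set (HardySpace F)))
    (hS : ∀ f ∈ S, mulZ F f ∈ S) :
    ∃ U : HardySpace (wandering S) →ₗᵢ[ℂ] HardySpace F,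
      (∀ f, U (mulZ _ f) = mulZ F (U f)) ∧ (S : Set (HardySpace F)) = Set.range U := by
  have : CompleteSpace (wandering S) := (isClosed_wandering hSc).completeSpace_coe
  have hV := orthogonalFamily_wanderingEmb hS
  -- Taylor coefficients in the wandering subspace are sent to `∑ zⁿ wₙ`, an orthogonal sum.
  let U : HardySpace (wandering S) →ₗᵢ[ℂ] HardySpace F := hV.linearIsometry.comp taylorIsometry
  have hU : ∀ n w, U (monomial n w) = wanderingEmb S n w := fun n w => by
    change hV.linearIsometry (taylorLin (monomial n w)) = _
    rw [taylorLin_monomial, hV.linearIsometry_apply_single]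
  refine ⟨U, fun f => ?_, ?_⟩
  · have h : U.toContinuousLinearMap ∘L mulZ _ = mulZ F ∘L U.toContinuousLinearMap :=
      clm_ext fun n w => by
        change U (mulZ _ (monomial n w)) = mulZ F (U (monomial n w))
        rw [mulZ_monomial, hU, hU, wanderingEmb_succ]
    exact DFunLike.congr_fun h f
  · have h1 : (S : Set (HardySpace F)) = Set.range hV.linearIsometry := by
      have h2 := hV.range_linearIsometry.trans (topologicalClosure_iSup_wanderingEmb hSc hS)
      exact (congrArg SetLike.coe h2).symm
    rw [h1]
    exact (taylorIsometry_surjective.range_comp hV.linearIsometry).symm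

end Wold

/-! ### Transport and uniqueness of symbols -/

section Symbol

variable {E : Type*} [NormedAddCommGroup E] [InnerProductSpace ℂ E] [CompleteSpace E]
variable {F : Type*} [NormedAddCommGroup F] [InnerProductSpace ℂ F] [CompleteSpace F]

theorem isModuleMap_hardyModule_iff {B : E →L[ℂ] E} {A : F →L[ℂ] F}
    {X : HardySpace E →L[ℂ] HardySpace F} :
    (hardyModule B).IsModuleMap (hardyModule A) X ↔
      (∀ f, X (pencil B f) = pencil A (X f)) ∧ ∀ f, X (mulZ E f) = mulZ F (X f) := by
  refine Fin.forall_fin_two.trans (and_congr ?_ ?_)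
  · exact ContinuousLinearMap.ext_iff
  · exact ContinuousLinearMap.ext_iff

theorem isSubmodule_hardyModule_iff {A : F →L[ℂ] F} {S : Submodule ℂ (HardySpace F)} :
    (hardyModule A).IsSubmodule S ↔ IsClosed (S : Set (HardySpace F)) ∧
      (∀ f ∈ S, pencil A f ∈ S) ∧ ∀ f ∈ S, mulZ F f ∈ S :=
  and_congr_right fun _ => Fin.forall_fin_two

theorem pencil_monomial_zero_apply_zero (B : E →L[ℂ] E) (x : E) :
    pencil B (monomial 0 x) 0 = B x := by
  rw [pencil_monomial_zero, add_apply, mulZ_apply]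
  simp

theorem pencil_injective : Function.Injective (pencil : (E →L[ℂ] E) → _) := fun B B' h => by
  ext x
  rw [← pencil_monomial_zero_apply_zero, h, pencil_monomial_zero_apply_zero]

/-- If the range of an isometry that intertwines the multiplications by `z` is invariant under
`A + A* M_z`, then the isometry pulls `A + A* M_z` back to an operator of the same form. -/
theorem exists_pencil_intertwining {A : F →L[ℂ] F} (hA : numericalRadius A ≤ 1)
    {U : HardySpace E →ₗᵢ[ℂ] HardySpace F} (hU : ∀ f, U (mulZ E f) = mulZ F (U f))
    (hinv : ∀ f, pencil A (U f) ∈ Set.range U) :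
    ∃ B : E →L[ℂ] E, numericalRadius B ≤ 1 ∧ ∀ f, U (pencil B f) = pencil A (U f) := by
  let X := U.toContinuousLinearMap
  -- `X X*` is the projection onto the range of `U`; invariance of that range gives `U R = P_A U`.
  let R : HardySpace E →L[ℂ] HardySpace E := ContinuousLinearMap.adjoint X ∘L pencil A ∘L X
  have hUR : ∀ f, U (R f) = pencil A (U f) := fun f => by
    obtain ⟨g, hg⟩ := hinv f
    have hR : R f = g := by
      refine ext_inner_left ℂ fun v => ?_
      change ⟪v, ContinuousLinearMap.adjoint X (pencil A (U f))⟫_ℂ = _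
      rw [ContinuousLinearMap.adjoint_inner_right, ← hg]
      exact U.inner_map_map v g
    rw [hR, hg]
  have hRz : ∀ f, R (mulZ E f) = mulZ E (R f) := fun f => U.injective <| by
    rw [hUR, hU, pencil_mulZ, hU, hUR]
  have hR' : ∀ f g, ⟪R f, g⟫_ℂ = ⟪mulZ E f, R g⟫_ℂ := fun f g => by
    rw [← U.inner_map_map, ← U.inner_map_map, hUR, hUR, hU, inner_pencil_left]
  obtain ⟨B, hB⟩ := exists_eq_pencil hRz hR'
  rw [hB] at hUR
  refine ⟨B, numericalRadius_le_one_of_pencil fun f => ?_, hUR⟩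
  rw [← U.inner_map_map, hUR, ← U.norm_map]
  exact norm_inner_pencil_le hA (U f)

omit [CompleteSpace E] [CompleteSpace F] in
/-- A unitary that intertwines the multiplications by `z` maps constants to constants. -/
theorem map_monomial_zero (W : HardySpace E ≃ₗᵢ[ℂ] HardySpace F)
    (hW : ∀ f, W (mulZ E f) = mulZ F (W f)) (x : E) :
    W (monomial 0 x) = monomial 0 (W (monomial 0 x) 0) := by
  refine eq_monomial_zero fun g => ?_
  -- As `W` is onto, `z g = W (z W⁻¹ g)`, so `W` carries the orthogonal complement of the range of
  -- `M_z` into its counterpart.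
  rw [← W.apply_symm_apply g, ← hW, LinearIsometryEquiv.inner_map_map, inner_mulZ_monomial_zero]

-- Both `W` and its inverse preserve constants, so their restrictions to constants are mutually
-- inverse.
omit [CompleteSpace E] [CompleteSpace F] in
theorem exists_unitary_of_hardySpace_unitary (W : HardySpace E ≃ₗᵢ[ℂ] HardySpace F)
    (hW : ∀ f, W (mulZ E f) = mulZ F (W f)) :
    ∃ W₀ : E ≃ₗᵢ[ℂ] F, ∀ x, W (monomial 0 x) = monomial 0 (W₀ x) := by
  have hW' : ∀ f, W.symm (mulZ F f) = mulZ E (W.symm f) := fun f => by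
    rw [W.symm_apply_eq, hW, W.apply_symm_apply]
  have h := map_monomial_zero W hW
  have h' := map_monomial_zero W.symm hW'
  let T : E →ₗ[ℂ] F :=
    { toFun := fun x => W (monomial 0 x) 0
      map_add' := fun x y => by simp
      map_smul' := fun c x => by simp }
  let T₀ : E →ₗᵢ[ℂ] F := ⟨T, fun x => by
    rw [← (monomial 0).norm_map]
    change ‖monomial 0 (W (monomial 0 x) 0)‖ = _
    rw [← h, W.norm_map, LinearIsometry.norm_map]⟩
  refine ⟨LinearIsometryEquiv.ofSurjective T₀ fun y => ⟨W.symm (monomial 0 y) 0, ?_⟩, h⟩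
  change W (monomial 0 (W.symm (monomial 0 y) 0)) 0 = y
  rw [← h', W.apply_symm_apply, monomial_apply]
  simp

/-- Intertwining isometries with the same range have unitarily equivalent symbols. -/
theorem exists_unitary_of_range_eq {G : Type*} [NormedAddCommGroup G] [InnerProductSpace ℂ G]
    [CompleteSpace G] {A : G →L[ℂ] G} {B : E →L[ℂ] E} {B' : F →L[ℂ] F}
    {U : HardySpace E →ₗᵢ[ℂ] HardySpace G} {U' : HardySpace F →ₗᵢ[ℂ] HardySpace G}
    (hU : ∀ f, U (mulZ E f) = mulZ G (U f)) (hU' : ∀ f, U' (mulZ F f) = mulZ G (U' f))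
    (hB : ∀ f, U (pencil B f) = pencil A (U f)) (hB' : ∀ f, U' (pencil B' f) = pencil A (U' f))
    (hr : Set.range U = Set.range U') : ∃ W : E ≃ₗᵢ[ℂ] F, ∀ x, W (B x) = B' (W x) := by
  have hex : ∀ f, ∃ g, U' g = U f := fun f => by
    change U f ∈ Set.range U'
    rw [← hr]
    exact Set.mem_range_self f
  -- `φ` is `U'⁻¹ U`; injectivity of `U'` makes it linear, and equality of the ranges makes it onto.
  choose φ hφ using hex
  let T : HardySpace E →ₗᵢ[ℂ] HardySpace F :=
    { toFun := φ
      map_add' := fun f g => U'.injective <| by simp only [map_add, hφ]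
      map_smul' := fun c f => U'.injective <| by simp only [map_smul, hφ, RingHom.id_apply]
      norm_map' := fun f => by
        change ‖φ f‖ = ‖f‖
        rw [← U'.norm_map, hφ, U.norm_map] }
  let W : HardySpace E ≃ₗᵢ[ℂ] HardySpace F := LinearIsometryEquiv.ofSurjective T fun g => by
    obtain ⟨f, hf⟩ : U' g ∈ Set.range U := hr ▸ Set.mem_range_self g
    exact ⟨f, U'.injective ((hφ f).trans hf)⟩
  have hWφ : ∀ f, U' (W f) = U f := hφ
  have hWz : ∀ f, W (mulZ E f) = mulZ F (W f) := fun f => U'.injective <| by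
    rw [hWφ, hU, hU', hWφ]
  have hWB : ∀ f, W (pencil B f) = pencil B' (W f) := fun f => U'.injective <| by
    rw [hWφ, hB, hB', hWφ]
  obtain ⟨W₀, hW₀⟩ := exists_unitary_of_hardySpace_unitary W hWz
  refine ⟨W₀, fun x => ?_⟩
  -- Evaluation at `0` removes the `B* M_z` part and leaves the symbols.
  have h := congrArg (fun f : HardySpace F => f 0) (hWB (monomial 0 x))
  simp only [hW₀, pencil_monomial_zero_apply_zero] at h
  rw [← h, pencil_monomial_zero, map_add, hWz, hW₀, add_apply, mulZ_apply]
  simp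

end Symbol

end HardySpace

end

/-! ### The corollary -/

theorem mainTheorem3 {Estar : Type u} [NormedAddCommGroup Estar] [InnerProductSpace ℂ Estar]
    [CompleteSpace Estar] [TopologicalSpace.SeparableSpace Estar]
    (A : Estar →L[ℂ] Estar) (hA : numericalRadius A ≤ 1)
    (S : Submodule ℂ (HardySpace Estar)) (hS : IsClosed (S : Set (HardySpace Estar)))
    (hS0 : S ≠ ⊥) :
    (hardyModule A).IsSubmodule S ↔
      ∃ (E : Type u) (_ : NormedAddCommGroup E) (_ : InnerProductSpace ℂ E)
        (_ : CompleteSpace E) (_ : TopologicalSpace.SeparableSpace E)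
        (B : E →L[ℂ] E) (U : HardySpace E →ₗᵢ[ℂ] HardySpace Estar),
        numericalRadius B ≤ 1 ∧
        (hardyModule B).IsModuleMap (hardyModule A) U.toContinuousLinearMap ∧
        (S : Set (HardySpace Estar)) = Set.range U ∧
        -- for the given map `U`, the symbol `B` is unique
        (∀ B' : E →L[ℂ] E,
          (hardyModule B').IsModuleMap (hardyModule A) U.toContinuousLinearMap → B' = B) ∧
        -- among all representations of `S`, the symbol `B` is unique up to unitary equivalence
        (∀ (E' : Type u) [NormedAddCommGroup E'] [InnerProductSpace ℂ E'] [CompleteSpace E']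
          [TopologicalSpace.SeparableSpace E'] (B' : E' →L[ℂ] E')
          (U' : HardySpace E' →ₗᵢ[ℂ] HardySpace Estar),
          numericalRadius B' ≤ 1 →
          (hardyModule B').IsModuleMap (hardyModule A) U'.toContinuousLinearMap →
          (S : Set (HardySpace Estar)) = Set.range U' →
          ∃ W : E ≃ₗᵢ[ℂ] E', ∀ x : E, W (B x) = B' (W x)) := by
  rw [HardySpace.isSubmodule_hardyModule_iff]
  constructor
  · rintro ⟨-, hSA, hSz⟩
    have : CompleteSpace (HardySpace.wandering S) :=
      (HardySpace.isClosed_wandering hS).completeSpace_coe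
    -- Second countability, unlike separability, passes to arbitrary subspaces, here to the
    -- wandering subspace.
    have : SecondCountableTopology (HardySpace Estar) :=
      UniformSpace.secondCountable_of_separable _
    obtain ⟨U, hU, hr⟩ := HardySpace.exists_linearIsometry_range_eq hS hSz
    obtain ⟨B, hB1, hB⟩ := HardySpace.exists_pencil_intertwining hA hU fun f => by
      rw [← hr]
      exact hSA _ (show U f ∈ (S : Set (HardySpace Estar)) from hr ▸ Set.mem_range_self f)
    refine ⟨HardySpace.wandering S, inferInstance, inferInstance, inferInstance, inferInstance,
      B, U, hB1, HardySpace.isModuleMap_hardyModule_iff.2 ⟨hB, hU⟩, hr, fun B' hB' => ?_, ?_⟩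
    · refine HardySpace.pencil_injective (ContinuousLinearMap.ext fun f => U.injective ?_)
      exact ((HardySpace.isModuleMap_hardyModule_iff.1 hB').1 f).trans (hB f).symm
    · intro E' _ _ _ _ B' U' _ hU' hr'
      obtain ⟨hB', hUz'⟩ := HardySpace.isModuleMap_hardyModule_iff.1 hU'
      exact HardySpace.exists_unitary_of_range_eq hU hUz' hB hB' (hr.symm.trans hr')
  · rintro ⟨E, _, _, _, _, B, U, -, hU, hr, -, -⟩
    obtain ⟨hB, hUz⟩ := HardySpace.isModuleMap_hardyModule_iff.1 hU
    have hmem : ∀ f, f ∈ S ↔ f ∈ Set.range U := fun f => by rw [← hr, SetLike.mem_coe]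
    refine ⟨hS, fun f hf => ?_, fun f hf => ?_⟩
    · obtain ⟨g, rfl⟩ := (hmem f).1 hf
      exact (hmem _).2 ⟨HardySpace.pencil B g, hB g⟩
    · obtain ⟨g, rfl⟩ := (hmem f).1 hf
      exact (hmem _).2 ⟨HardySpace.mulZ E g, hUz g⟩
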